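/- Let $r>0$ and $c_0>0$. There exists a constant $C=C(r,c_0)>0$, depending only on $r$ and $c_0$, such that the following holds for every integer $n\ge 1$ and every real $d$. Let $A=(a_{ij})_{1\le i,j\le n}$ be the adjacency matrix of a random simple undirected graph on $n$ nodes in which edges occur independently; that is, $A$ is symmetric with entries in $\{0,1\}$ and zero diagonal, and the entries $a_{ij}$, $i<j$, are independent Bernoulli random variables (not necessarily identically distributed). Let $P=(p_{ij})_{1\le i,j\le n}=\mathbb{E}[A]$, and assume that $$n\max_{i,j}p_{ij}\le d\qquad\text{and}\qquad d\ge c_0\log n .$$ Then, with $\|\cdot\|$ the spectral norm, $$\mathbb{P}\bigl(\|A-P\|\le C\sqrt d\,\bigr)\ \ge\ 1-n^{-r}.$$ -/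

import Mathlib

open MeasureTheory ProbabilityTheory

/-- A random (simple, undirected) graph on `n` labelled nodes, defined on the probability space
`(Ω, μ)`, in which edges occur independently: the events "`e` is an edge", where `e` ranges over
the unordered pairs of distinct nodes, are measurable and mutually independent.  The edge
probabilities are arbitrary. -/
structure IndependentEdges {Ω : Type*} [MeasurableSpace Ω] (μ : Measure Ω) {n : ℕ}
    (G : Ω → SimpleGraph (Fin n)) : Prop where
  measurable : ∀ e : {e : Sym2 (Fin n) // ¬ e.IsDiag}, MeasurableSet {ω | e.1 ∈ (G ω).edgeSet}
  indep : iIndepSet (fun e : {e : Sym2 (Fin n) // ¬ e.IsDiag} => {ω | e.1 ∈ (G ω).edgeSet}) μ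

open Classical in
/-- The `0`-`1` adjacency matrix of a graph on `n` labelled nodes. -/
noncomputable def adjacencyMatrix {n : ℕ} (G : SimpleGraph (Fin n)) :
    Matrix (Fin n) (Fin n) ℝ :=
  G.adjMatrix ℝ

/-- The entrywise expectation of a random matrix. -/
noncomputable def matrixExpectation {Ω : Type*} [MeasurableSpace Ω] (μ : Measure Ω) {n : ℕ}
    (A : Ω → Matrix (Fin n) (Fin n) ℝ) : Matrix (Fin n) (Fin n) ℝ :=
  Matrix.of fun i j => ∫ ω, A ω i j ∂μ

/-- The spectral norm of a square real matrix, that is, the norm of the operator it defines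
on Euclidean space. -/
noncomputable def matrixSpectralNorm {n : ℕ} (M : Matrix (Fin n) (Fin n) ℝ) : ℝ :=
  ‖Matrix.toEuclideanCLM (n := Fin n) (𝕜 := ℝ) M‖

/-! The proof is a moment method whose combinatorial count is done by a second random matrix. With
`k` a power of two comparable to `d` and large against `log n`, the spectral norm of `M = A - P` to
the power `2k` is at most `tr M ^ (2k)`, a sum over closed walks. Independence and centring kill
every walk that uses some edge exactly once. Any other walk has expectation at most `q ^ (v - 1)`,
where `v` is the number of vertices visited and `q = min 1 (d / n)` bounds the variances.

These walks are not enumerated. A pattern of coincidences with `v` classes is realised by at most `n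
^ v` walks on `n` vertices, and `n q ≤ k` makes their total weight at most `n k ^ (v - 1)`. Since `v
≤ k + 1`, this is at most `n` times the number of walks with the same pattern on `2k + 1` vertices
(`sum_repeated_closed_walks_le`). So the sparse weighted sum is bounded by `n` times an unweighted
count on a small vertex set.

That count is at most the mean trace of the `2k`-th power of a dense symmetric matrix with centred
entries whose other moments are all at least one (`card_repeated_closed_walks_le`). Its dimension is
comparable to `k`, so a net argument with sub-Gaussian moments costs only a factor exponential in
`k` and gives `(const * k) ^ k` (`sum_trace_threePointMatrix_pow_le`). Markov's inequality then
leaves a tail `n * exp (-k)`, at most `n ^ (-r)`. -/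

/-! ### Powers and traces of a matrix as sums over walks. -/

section Walks

variable {V : Type*}

/-- The unordered pair traversed by the `l`-th step of a walk. -/
def stepEdge {m : ℕ} (w : Fin (m + 1) → V) (l : Fin m) : Sym2 V :=
  s(w l.castSucc, w l.succ)

theorem matrix_pow_apply_eq_sum_walks [Fintype V] [DecidableEq V] (M : Matrix V V ℝ) (m : ℕ)
    (i j : V) :
    (M ^ m) i j = ∑ w : Fin (m + 1) → V,
      if w 0 = i ∧ w (Fin.last m) = j then ∏ l : Fin m, M (w l.castSucc) (w l.succ) else 0 := by
  induction m generalizing i with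
  | zero =>
    rw [← (Equiv.funUnique (Fin 1) V).symm.sum_comp]
    have h0 : ∀ v : V, (Equiv.funUnique (Fin 1) V).symm v (Fin.last 0) = v := fun _ => rfl
    have h1 : ∀ v : V, (Equiv.funUnique (Fin 1) V).symm v 0 = v := fun _ => rfl
    simp only [h0, h1, Finset.univ_eq_empty, Finset.prod_empty, ite_and, pow_zero,
      Matrix.one_apply]
    rw [Finset.sum_ite_eq' Finset.univ i, if_pos (Finset.mem_univ _)]
  | succ m ih =>
    rw [pow_succ', Matrix.mul_apply, ← (Fin.consEquiv fun _ => V).sum_comp, Fintype.sum_prod_type]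
    have key : ∀ (a : V) (w : Fin (m + 1) → V),
        (if (Fin.consEquiv fun _ => V) (a, w) 0 = i ∧
            (Fin.consEquiv fun _ => V) (a, w) (Fin.last (m + 1)) = j then
          ∏ l : Fin (m + 1), M ((Fin.consEquiv fun _ => V) (a, w) l.castSucc)
            ((Fin.consEquiv fun _ => V) (a, w) l.succ) else 0) =
        if a = i then (if w (Fin.last m) = j then
          M a (w 0) * ∏ l : Fin m, M (w l.castSucc) (w l.succ) else 0) else 0 := by
      intro a w
      have h1 : (Fin.cons a w : Fin (m + 2) → V) (Fin.last (m + 1)) = w (Fin.last m) := by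
        rw [← Fin.succ_last, Fin.cons_succ]
      have h2 : ∀ l : Fin m, (Fin.cons a w : Fin (m + 2) → V) l.succ.castSucc = w l.castSucc := by
        intro l
        rw [← Fin.succ_castSucc, Fin.cons_succ]
      simp only [Fin.consEquiv, Equiv.coe_fn_mk, Fin.cons_zero, h1, Fin.prod_univ_succ,
        Fin.castSucc_zero, Fin.cons_succ, h2]
      split_ifs <;> simp_all
    simp_rw [key]
    simp only [ih, Finset.mul_sum]
    rw [Finset.sum_comm, Finset.sum_comm (γ := V)]
    refine Finset.sum_congr rfl fun w _ => ?_
    rw [Finset.sum_ite_eq' Finset.univ i, if_pos (Finset.mem_univ _)]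
    simp only [mul_ite, mul_zero, ite_and]
    rw [Finset.sum_ite_eq Finset.univ (w 0), if_pos (Finset.mem_univ _)]

theorem trace_pow_eq_sum_closed_walks [Fintype V] [DecidableEq V] (M : Matrix V V ℝ) (m : ℕ) :
    (M ^ m).trace = ∑ w : Fin (m + 1) → V with w 0 = w (Fin.last m),
      ∏ l : Fin m, M (w l.castSucc) (w l.succ) := by
  simp only [Matrix.trace, Matrix.diag_apply, matrix_pow_apply_eq_sum_walks]
  rw [Finset.sum_comm, Finset.sum_filter]
  refine Finset.sum_congr rfl fun w _ => ?_
  simp only [ite_and]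
  rw [Finset.sum_ite_eq Finset.univ (w 0), if_pos (Finset.mem_univ _)]
  simp only [eq_comm]

end Walks

/-! ### Spectral norm against trace. -/

section SpectralNorm

variable {n : ℕ}

theorem sq_matrixSpectralNorm_le_sum_sq (M : Matrix (Fin n) (Fin n) ℝ) :
    matrixSpectralNorm M ^ 2 ≤ ∑ i, ∑ j, M i j ^ 2 := by
  have h0 : 0 ≤ ∑ i, ∑ j, M i j ^ 2 := by positivity
  have : matrixSpectralNorm M ≤ √(∑ i, ∑ j, M i j ^ 2) := by
    refine ContinuousLinearMap.opNorm_le_bound _ (Real.sqrt_nonneg _) fun x => ?_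
    rw [EuclideanSpace.norm_eq, EuclideanSpace.norm_eq, ← Real.sqrt_mul h0]
    refine Real.sqrt_le_sqrt ?_
    rw [Finset.sum_mul]
    refine Finset.sum_le_sum fun i _ => ?_
    simp only [Real.norm_eq_abs, sq_abs]
    exact Finset.sum_mul_sq_le_sq_mul_sq Finset.univ (M i) x
  calc matrixSpectralNorm M ^ 2 ≤ √(∑ i, ∑ j, M i j ^ 2) ^ 2 :=
        pow_le_pow_left₀ (norm_nonneg _) this 2
    _ = _ := Real.sq_sqrt h0

theorem matrixSpectralNorm_pow_two_pow {M : Matrix (Fin n) (Fin n) ℝ} (hM : M.IsSymm) (j : ℕ) :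
    matrixSpectralNorm (M ^ 2 ^ j) = matrixSpectralNorm M ^ 2 ^ j := by
  have hs : IsSelfAdjoint M := by
    rw [IsSelfAdjoint, Matrix.star_eq_conjTranspose, Matrix.conjTranspose_eq_transpose_of_trivial]
    exact hM
  have h : IsSelfAdjoint (Matrix.toEuclideanCLM (n := Fin n) (𝕜 := ℝ) M) := hs.map _
  have := IsSelfAdjoint.norm_pow_two_pow
    (E := EuclideanSpace ℝ (Fin n) →L[ℝ] EuclideanSpace ℝ (Fin n)) h j
  rw [matrixSpectralNorm, map_pow, this, matrixSpectralNorm]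

/-- The trace is the squared Frobenius norm of `M ^ 2 ^ j`. Exponents are powers of two because
iterating the C*-identity gives exactly these, with no diagonalisation. -/
theorem matrixSpectralNorm_pow_le_trace {M : Matrix (Fin n) (Fin n) ℝ} (hM : M.IsSymm) (j : ℕ) :
    matrixSpectralNorm M ^ (2 * 2 ^ j) ≤ (M ^ (2 * 2 ^ j)).trace := by
  rw [mul_comm, pow_mul, ← matrixSpectralNorm_pow_two_pow hM]
  refine (sq_matrixSpectralNorm_le_sum_sq _).trans_eq ?_
  rw [pow_mul, sq (M ^ 2 ^ j), Matrix.trace]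
  refine Finset.sum_congr rfl fun i _ => ?_
  rw [Matrix.diag_apply, Matrix.mul_apply]
  refine Finset.sum_congr rfl fun l _ => ?_
  rw [(hM.pow (2 ^ j)).apply i l, sq]

theorem matrixSpectralNorm_pow_le (M : Matrix (Fin n) (Fin n) ℝ) {m : ℕ} (hm : 0 < m) :
    matrixSpectralNorm (M ^ m) ≤ matrixSpectralNorm M ^ m := by
  rw [matrixSpectralNorm, map_pow]
  exact norm_pow_le' _ hm

theorem trace_le_mul_matrixSpectralNorm (M : Matrix (Fin n) (Fin n) ℝ) :
    M.trace ≤ n * matrixSpectralNorm M := by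
  have : ∀ i, M i i ≤ matrixSpectralNorm M := by
    intro i
    have h1 := (Matrix.toEuclideanCLM (n := Fin n) (𝕜 := ℝ) M).le_opNorm
      (EuclideanSpace.single i 1)
    have h2 := PiLp.norm_apply_le (Matrix.toEuclideanCLM (n := Fin n) (𝕜 := ℝ) M
      (EuclideanSpace.single i 1)) i
    have h3 : Matrix.toEuclideanCLM (n := Fin n) (𝕜 := ℝ) M (EuclideanSpace.single i 1) i
        = M i i := by
      simp [Matrix.ofLp_toEuclideanCLM]
    rw [h3, Real.norm_eq_abs] at h2
    simp only [PiLp.norm_single, norm_one, mul_one] at h1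
    exact (le_abs_self _).trans (h2.trans h1)
  calc M.trace ≤ ∑ _i : Fin n, matrixSpectralNorm M := Finset.sum_le_sum fun i _ => this i
    _ = _ := by simp

end SpectralNorm

/-! ### Walks with every edge repeated, and transfer to a small vertex set. -/

section RepeatedWalks

variable {V W : Type*} {m : ℕ}

/-- Every edge used by the walk is used by at least two steps. -/
def EveryStepRepeated (w : Fin (m + 1) → V) : Prop :=
  ∀ l, ∃ l', l' ≠ l ∧ stepEdge w l' = stepEdge w l

theorem everyStepRepeated_comp {φ : V → W} (hφ : φ.Injective) (w : Fin (m + 1) → V) :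
    EveryStepRepeated (φ ∘ w) ↔ EveryStepRepeated w := by
  have h : ∀ l, stepEdge (φ ∘ w) l = Sym2.map φ (stepEdge w l) := fun l => rfl
  simp only [EveryStepRepeated, h, (Sym2.map.injective hφ).eq_iff]

/-- A connected graph has at most one more vertex than edges. -/
theorem card_image_walk_le [DecidableEq V] (w : Fin (m + 1) → V) :
    (Finset.univ.image w).card ≤ (Finset.univ.image (stepEdge w)).card + 1 := by
  induction m with
  | zero => exact Finset.card_image_le.trans (by simp)
  | succ m ih =>
    have hw : Finset.univ.image w =
        insert (w (Fin.last _)) (Finset.univ.image fun i : Fin (m + 1) => w i.castSucc) := by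
      ext v
      simp [Fin.exists_fin_succ', or_comm, eq_comm]
    have he : Finset.univ.image (stepEdge w) = insert (stepEdge w (Fin.last _))
        (Finset.univ.image (stepEdge fun i : Fin (m + 1) => w i.castSucc)) := by
      ext e
      simp [Fin.exists_fin_succ', or_comm, eq_comm, stepEdge]
    have := ih fun i => w i.castSucc
    by_cases h : w (Fin.last _) ∈ Finset.univ.image fun i : Fin (m + 1) => w i.castSucc
    · rw [hw, Finset.insert_eq_of_mem h]
      refine this.trans (Nat.add_le_add_right (Finset.card_le_card ?_) 1)
      rw [he]
      exact Finset.subset_insert _ _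
    · have h' : stepEdge w (Fin.last _) ∉
          Finset.univ.image (stepEdge fun i : Fin (m + 1) => w i.castSucc) := by
        intro hmem
        simp only [Finset.mem_image, Finset.mem_univ, true_and, not_exists] at h hmem
        obtain ⟨l, hl⟩ := hmem
        have hv : w (Fin.last _) ∈ stepEdge w (Fin.last m) := by
          simp [stepEdge]
        rw [← hl, stepEdge, Sym2.mem_iff] at hv
        rcases hv with hv | hv
        · exact h _ hv.symm
        · exact h _ hv.symm
      rw [hw, he, Finset.card_insert_of_notMem h, Finset.card_insert_of_notMem h']
      omega

theorem EveryStepRepeated.two_mul_card_le [DecidableEq V] {w : Fin (m + 1) → V}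
    (hw : EveryStepRepeated w) : 2 * (Finset.univ.image (stepEdge w)).card ≤ m := by
  have h := Finset.card_eq_sum_card_image (stepEdge w) Finset.univ
  rw [Finset.card_univ, Fintype.card_fin] at h
  refine le_of_le_of_eq ?_ h.symm
  rw [mul_comm, ← smul_eq_mul]
  refine Finset.card_nsmul_le_sum _ _ _ fun e he => ?_
  obtain ⟨l, -, rfl⟩ := Finset.mem_image.1 he
  obtain ⟨l', hne, hl'⟩ := hw l
  refine Finset.one_lt_card.2 ⟨l', ?_, l, ?_, hne⟩ <;> simp [hl']

/-- The partition of the time set by the position of a closed walk each of whose edges is used at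
least twice. -/
def IsRepeatedClosed (s : Setoid (Fin (m + 1))) : Prop :=
  s 0 (Fin.last m) ∧ EveryStepRepeated (Quotient.mk s)

theorem isRepeatedClosed_ker (w : Fin (m + 1) → V) :
    IsRepeatedClosed (Setoid.ker w) ↔ w 0 = w (Fin.last m) ∧ EveryStepRepeated w :=
  and_congr Iff.rfl (everyStepRepeated_comp (Setoid.kerLift_injective w) _).symm

open Classical in
theorem card_quotient_ker (w : Fin (m + 1) → V) :
    Fintype.card (Quotient (Setoid.ker w)) = (Finset.univ.image w).card := by
  rw [Fintype.card_congr (Setoid.quotientKerEquivRange w), ← Set.toFinset_card,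
    Set.toFinset_range]

-- At most `k` distinct edges are used, and a walk visits at most one vertex more than it has
-- distinct edges.
open Classical in
theorem IsRepeatedClosed.card_quotient_le {k : ℕ} {s : Setoid (Fin (2 * k + 1))}
    (hs : IsRepeatedClosed s) : Fintype.card (Quotient s) ≤ k + 1 := by
  have h1 := card_image_walk_le (Quotient.mk s)
  have h2 := hs.2.two_mul_card_le
  rw [Finset.image_univ_of_surjective Quotient.mk_surjective, Finset.card_univ] at h1
  omega

-- A map with kernel `s` is the same thing as an embedding of the quotient by `s`.
open Classical in
theorem card_filter_ker_eq {α : Type*} [Fintype α] [Fintype V] (s : Setoid α) :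
    (Finset.univ.filter fun w : α → V => Setoid.ker w = s).card =
      (Fintype.card V).descFactorial (Fintype.card (Quotient s)) := by
  rw [← Fintype.card_embedding_eq, ← Finset.card_univ]
  symm
  refine Finset.card_bij (fun φ _ => φ ∘ Quotient.mk s) ?_ ?_ ?_
  · intro φ _
    simp only [Finset.mem_filter, Finset.mem_univ, true_and]
    ext a b
    simp [Setoid.ker_def, φ.injective.eq_iff, Quotient.eq]
  · intro φ _ ψ _ h
    ext a
    obtain ⟨a, rfl⟩ := Quotient.mk_surjective a
    exact congrFun h a
  · intro w hw
    obtain rfl := (Finset.mem_filter.1 hw).2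
    exact ⟨⟨Setoid.kerLift w, Setoid.kerLift_injective w⟩, Finset.mem_univ _, rfl⟩

open Classical in
theorem sum_ker_eq {α : Type*} [Fintype α] [Fintype (Setoid α)] [Fintype V] (F : Setoid α → ℝ) :
    ∑ w : α → V, F (Setoid.ker w) =
      ∑ s : Setoid α, ((Fintype.card V).descFactorial (Fintype.card (Quotient s)) : ℝ) * F s := by
  rw [← Finset.sum_fiberwise Finset.univ (fun w : α → V => Setoid.ker w)]
  refine Finset.sum_congr rfl fun s _ => ?_
  rw [← card_filter_ker_eq, ← nsmul_eq_mul, ← Finset.sum_const]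
  refine Finset.sum_congr rfl fun w hw => ?_
  rw [(Finset.mem_filter.1 hw).2]

open Classical in
/-- Weighted walks on a large vertex set are dominated by unweighted walks on a small one. -/
theorem sum_repeated_closed_walks_le [Fintype V] [Fintype W] {k : ℕ} (hk : 1 ≤ k)
    (hW : Fintype.card W = 2 * k + 1) {q : ℝ} (hq : 0 ≤ q) (hqk : Fintype.card V * q ≤ k) :
    ∑ w : Fin (2 * k + 1) → V with IsRepeatedClosed (Setoid.ker w),
        q ^ ((Finset.univ.image w).card - 1) ≤
      Fintype.card V *
        ((Finset.univ.filter fun w : Fin (2 * k + 1) → W =>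
          IsRepeatedClosed (Setoid.ker w)).card : ℝ) := by
  have : Finite (Setoid (Fin (2 * k + 1))) :=
    Finite.of_injective (fun s : Setoid (Fin (2 * k + 1)) => fun a b => s a b)
      fun s t h => Setoid.ext fun a b => by rw [show s a b = t a b from congrFun₂ h a b]
  have := Fintype.ofFinite (Setoid (Fin (2 * k + 1)))
  have h1 := sum_ker_eq (V := V) fun s : Setoid (Fin (2 * k + 1)) =>
    if IsRepeatedClosed s then q ^ (Fintype.card (Quotient s) - 1) else 0
  have h2 := sum_ker_eq (V := W) fun s : Setoid (Fin (2 * k + 1)) =>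
    if IsRepeatedClosed s then 1 else 0
  simp only [card_quotient_ker] at h1
  have h1' : ∑ w : Fin (2 * k + 1) → V with IsRepeatedClosed (Setoid.ker w),
        q ^ ((Finset.univ.image w).card - 1) =
      ∑ s : Setoid (Fin (2 * k + 1)),
        ((Fintype.card V).descFactorial (Fintype.card (Quotient s)) : ℝ) *
          if IsRepeatedClosed s then q ^ (Fintype.card (Quotient s) - 1) else 0 := by
    rw [Finset.sum_filter, ← h1]
    congr!
  have h2' : ((Finset.univ.filter fun w : Fin (2 * k + 1) → W =>
        IsRepeatedClosed (Setoid.ker w)).card : ℝ) =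
      ∑ s : Setoid (Fin (2 * k + 1)),
        ((Fintype.card W).descFactorial (Fintype.card (Quotient s)) : ℝ) *
          if IsRepeatedClosed s then 1 else 0 := by
    rw [← Finset.sum_boole, ← h2]
    congr!
  rw [h1', h2', Finset.mul_sum]
  refine Finset.sum_le_sum fun s _ => ?_
  split_ifs with hs
  · have hv := hs.card_quotient_le
    have : Nonempty (Quotient s) := ⟨⟦0⟧⟩
    obtain ⟨v, hv'⟩ : ∃ v, Fintype.card (Quotient s) = v + 1 :=
      Nat.exists_eq_succ_of_ne_zero (Fintype.card_ne_zero (α := Quotient s))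
    rw [hv', hW, mul_one, Nat.add_sub_cancel]
    have hk1 : (1 : ℝ) ≤ k := by exact_mod_cast hk
    -- As `v + 1 ≤ k + 1`, every factor of the falling factorial from `2k + 1` is at least `k + 1`.
    have hd : ((k ^ (v + 1) : ℕ) : ℝ) ≤ ((2 * k + 1).descFactorial (v + 1) : ℝ) := by
      refine Nat.cast_le.2 (le_trans ?_ (Nat.pow_sub_le_descFactorial _ _))
      exact Nat.pow_le_pow_left (by omega) _
    calc ((Fintype.card V).descFactorial (v + 1) : ℝ) * q ^ v
        ≤ (Fintype.card V : ℝ) ^ (v + 1) * q ^ v := by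
          gcongr
          exact_mod_cast Nat.descFactorial_le_pow _ _
      _ = Fintype.card V * (Fintype.card V * q) ^ v := by ring
      _ ≤ Fintype.card V * (k : ℝ) ^ v := by gcongr
      _ ≤ Fintype.card V * (k : ℝ) ^ (v + 1) := by
          gcongr
          omega
      _ ≤ _ := by
          gcongr
          exact_mod_cast hd
  · simp

end RepeatedWalks

/-! ### Half-nets of the unit ball and operator norms. -/

section Net

variable {E : Type*} [NormedAddCommGroup E] [NormedSpace ℝ E] [FiniteDimensional ℝ E]

theorem card_le_of_half_separated (s : Finset E) (hs : ∀ c ∈ s, ‖c‖ ≤ 1)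
    (h : ∀ c ∈ s, ∀ d ∈ s, c ≠ d → 1 / 2 ≤ ‖c - d‖) : s.card ≤ 5 ^ Module.finrank ℝ E := by
  classical
  have hinj : Function.Injective fun x : E => (2 : ℝ) • x := smul_right_injective E two_ne_zero
  rw [← Finset.card_image_of_injective s hinj]
  refine Besicovitch.card_le_of_separated _ ?_ ?_
  · simp only [Finset.forall_mem_image, norm_smul, Real.norm_ofNat]
    intro c hc
    linarith [hs c hc]
  · simp only [Finset.forall_mem_image, ← smul_sub, norm_smul, Real.norm_ofNat]
    intro c hc d hd hne
    linarith [h c hc d hd fun h => hne (by rw [h])]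

/-- Otherwise every small separated set could be extended by one point, beyond the volumetric bound
`5 ^ dim`. -/
theorem exists_half_net (E : Type*) [NormedAddCommGroup E] [NormedSpace ℝ E]
    [FiniteDimensional ℝ E] :
    ∃ N : Finset E, N.card ≤ 5 ^ Module.finrank ℝ E ∧ (∀ x ∈ N, ‖x‖ ≤ 1) ∧
      ∀ x : E, ‖x‖ ≤ 1 → ∃ y ∈ N, ‖x - y‖ ≤ 1 / 2 := by
  classical
  by_contra! hcon
  have key : ∀ m : ℕ, ∃ s : Finset E, s.card = m ∧ (∀ c ∈ s, ‖c‖ ≤ 1) ∧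
      ∀ c ∈ s, ∀ d ∈ s, c ≠ d → 1 / 2 ≤ ‖c - d‖ := by
    intro m
    induction m with
    | zero => exact ⟨∅, by simp⟩
    | succ m ih =>
      obtain ⟨s, hcard, h1, h2⟩ := ih
      obtain ⟨x, hx, hxs⟩ := hcon s (card_le_of_half_separated s h1 h2) h1
      have hxn : x ∉ s := fun h => by
        have := hxs x h
        norm_num at this
      refine ⟨insert x s, by rw [Finset.card_insert_of_notMem hxn, hcard], ?_, ?_⟩
      · simp only [Finset.forall_mem_insert]
        exact ⟨hx, h1⟩
      · simp only [Finset.forall_mem_insert]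
        refine ⟨⟨fun h => absurd rfl h, fun d hd _ => (hxs d hd).le⟩,
          fun c hc => ⟨fun _ => ?_, h2 c hc⟩⟩
        rw [norm_sub_rev]
        exact (hxs c hc).le
  obtain ⟨s, hcard, h1, h2⟩ := key (5 ^ Module.finrank ℝ E + 1)
  have := card_le_of_half_separated s h1 h2
  omega

/-- Two approximations, each costing a factor 2: the direction of `T x` by a net point, then the
unit vector `x` itself. -/
theorem opNorm_le_of_half_net {F : Type*} [NormedAddCommGroup F] [InnerProductSpace ℝ F]
    (T : F →L[ℝ] F) {N : Finset F} (hN : ∀ x : F, ‖x‖ ≤ 1 → ∃ y ∈ N, ‖x - y‖ ≤ 1 / 2) {b : ℝ}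
    (hb : ∀ x ∈ N, ∀ y ∈ N, inner ℝ y (T x) ≤ b) : ‖T‖ ≤ 4 * b := by
  have h1 : ∀ x ∈ N, ‖T x‖ ≤ 2 * b := by
    intro x hx
    obtain ⟨y, hy, hyu⟩ := hN ((‖T x‖)⁻¹ • T x) (by
      rw [norm_smul, norm_inv, norm_norm]
      exact inv_mul_le_one)
    have h : inner ℝ ((‖T x‖)⁻¹ • T x) (T x) = ‖T x‖ := by
      rw [real_inner_smul_left, real_inner_self_eq_norm_sq, sq]
      rcases eq_or_ne ‖T x‖ 0 with h0 | h0
      · simp [h0]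
      · field_simp
    have h' := real_inner_le_norm ((‖T x‖)⁻¹ • T x - y) (T x)
    rw [inner_sub_left, h] at h'
    nlinarith [hb x hx y hy, norm_nonneg (T x)]
  have hb0 : 0 ≤ b := by
    obtain ⟨y, hy, -⟩ := hN 0 (by simp)
    linarith [h1 y hy, norm_nonneg (T y)]
  have h2 : ‖T‖ ≤ 2 * b + ‖T‖ / 2 := by
    refine ContinuousLinearMap.opNorm_le_of_unit_norm (by positivity) fun x hx => ?_
    obtain ⟨y, hy, hyx⟩ := hN x hx.le
    calc ‖T x‖ = ‖T y + T (x - y)‖ := by rw [map_sub, add_sub_cancel]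
      _ ≤ ‖T y‖ + ‖T (x - y)‖ := norm_add_le _ _
      _ ≤ 2 * b + ‖T‖ * ‖x - y‖ := add_le_add (h1 y hy) (T.le_opNorm _)
      _ ≤ 2 * b + ‖T‖ / 2 := by nlinarith [norm_nonneg T]
  linarith

theorem opNorm_pow_le_of_half_net {F : Type*} [NormedAddCommGroup F] [InnerProductSpace ℝ F]
    (T : F →L[ℝ] F) {N : Finset F} (hN : ∀ x : F, ‖x‖ ≤ 1 → ∃ y ∈ N, ‖x - y‖ ≤ 1 / 2) (k : ℕ) :
    ‖T‖ ^ (2 * k) ≤ 16 ^ k * ∑ p ∈ N ×ˢ N, (inner ℝ p.2 (T p.1) : ℝ) ^ (2 * k) := by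
  have hne : (N ×ˢ N).Nonempty := by
    obtain ⟨y, hy, -⟩ := hN 0 (by simp)
    exact ⟨(y, y), Finset.mk_mem_product hy hy⟩
  obtain ⟨p, hp, hmax⟩ := Finset.exists_max_image (N ×ˢ N)
    (fun p => (inner ℝ p.2 (T p.1) : ℝ)) hne
  have h := opNorm_le_of_half_net T hN (b := inner ℝ p.2 (T p.1)) fun x hx y hy =>
    hmax (x, y) (Finset.mk_mem_product hx hy)
  calc ‖T‖ ^ (2 * k) ≤ (4 * inner ℝ p.2 (T p.1)) ^ (2 * k) :=
        pow_le_pow_left₀ (norm_nonneg _) h _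
    _ = 16 ^ k * (inner ℝ p.2 (T p.1) : ℝ) ^ (2 * k) := by
        rw [mul_pow, pow_mul]
        norm_num
    _ ≤ _ := by
        gcongr
        exact Finset.single_le_sum (f := fun p : F × F => (inner ℝ p.2 (T p.1) : ℝ) ^ (2 * k))
          (fun p _ => (even_two_mul k).pow_nonneg _) hp

end Net

/-! ### The dense comparison matrix: sub-Gaussian entries and mean trace. -/

section ThreePoint

/-- The linear term cancels on averaging a centred variable, which leaves a sub-Gaussian bound. -/
theorem exp_le_add_exp_sq (x : ℝ) : Real.exp x ≤ x + Real.exp (x ^ 2) := by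
  have h1 := Real.add_one_le_exp (x ^ 2)
  rcases le_or_gt |x| 1 with h | h
  · have := (abs_le.1 (Real.abs_exp_sub_one_sub_id_le h)).2
    linarith
  · rcases lt_abs.1 h with h | h
    · have : Real.exp x ≤ Real.exp (x ^ 2) := Real.exp_le_exp.2 (by nlinarith)
      linarith
    · have : Real.exp x ≤ 1 := Real.exp_le_one_iff.2 (by linarith)
      nlinarith

/-- A centred three-point distribution all of whose higher moments are at least one. -/
def threePoint : Fin 3 → ℝ := ![2, -1, -1]

theorem sum_threePoint_pow (m : ℕ) : ∑ j, threePoint j ^ m = 2 ^ m + 2 * (-1) ^ m := by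
  simp [threePoint, Fin.sum_univ_three]
  ring

/-- Skewness is essential: random signs would have vanishing odd moments, and walks using an edge an
odd number of times would be lost from the count. -/
theorem three_le_sum_threePoint_pow {m : ℕ} (hm : m ≠ 1) : 3 ≤ ∑ j, threePoint j ^ m := by
  rw [sum_threePoint_pow]
  rcases Nat.even_or_odd m with h | h
  · rw [h.neg_one_pow]
    have : (1 : ℝ) ≤ 2 ^ m := one_le_pow₀ (by norm_num)
    linarith
  · rw [h.neg_one_pow]
    obtain ⟨a, rfl⟩ := h
    have : (2 : ℝ) ^ 3 ≤ 2 ^ (2 * a + 1) := pow_le_pow_right₀ (by norm_num) (by omega)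
    linarith

theorem sum_threePoint_pow_nonneg (m : ℕ) : 0 ≤ ∑ j, threePoint j ^ m := by
  rcases eq_or_ne m 1 with rfl | h
  · rw [sum_threePoint_pow]
    norm_num
  · linarith [three_le_sum_threePoint_pow h]

theorem sum_exp_threePoint_le (s : ℝ) :
    ∑ j, Real.exp (s * threePoint j) ≤ 3 * Real.exp (4 * s ^ 2) := by
  have h1 := exp_le_add_exp_sq (2 * s)
  have h2 := exp_le_add_exp_sq (-s)
  have h3 : Real.exp ((-s) ^ 2) ≤ Real.exp (4 * s ^ 2) :=
    Real.exp_le_exp.2 (by nlinarith [sq_nonneg s])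
  have h4 : (2 * s) ^ 2 = 4 * s ^ 2 := by ring
  rw [h4] at h1
  rw [Fin.sum_univ_three]
  change Real.exp (s * 2) + Real.exp (s * -1) + Real.exp (s * -1) ≤ _
  rw [mul_comm s 2, mul_neg_one]
  linarith

variable {V : Type*} [Fintype V] [DecidableEq V]

/-- The symmetric matrix with entries in the three-point support selected by `η`. -/
def threePointMatrix (η : Sym2 V → Fin 3) : Matrix V V ℝ :=
  Matrix.of fun i j => threePoint (η s(i, j))

theorem sum_exp_linear_threePoint_le {ι : Type*} [Fintype ι] [DecidableEq ι] (a : ι → ℝ) (θ : ℝ)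
    (ha : ∑ e, a e ^ 2 ≤ 2) :
    ∑ η : ι → Fin 3, Real.exp (θ * ∑ e, a e * threePoint (η e)) ≤
      3 ^ Fintype.card ι * Real.exp (8 * θ ^ 2) := by
  calc ∑ η : ι → Fin 3, Real.exp (θ * ∑ e, a e * threePoint (η e))
      = ∏ e, ∑ j, Real.exp ((θ * a e) * threePoint j) := by
        rw [Fintype.prod_sum]
        refine Finset.sum_congr rfl fun η _ => ?_
        rw [← Real.exp_sum, Finset.mul_sum]
        simp only [mul_assoc]
    _ ≤ ∏ e, (3 * Real.exp (4 * (θ * a e) ^ 2)) :=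
        Finset.prod_le_prod (fun e _ => by positivity) fun e _ => sum_exp_threePoint_le _
    _ = 3 ^ Fintype.card ι * Real.exp (4 * θ ^ 2 * ∑ e, a e ^ 2) := by
        rw [Finset.prod_mul_distrib, ← Real.exp_sum, Finset.mul_sum]
        simp [mul_pow, mul_assoc]
    _ ≤ _ := by
        refine mul_le_mul_of_nonneg_left (Real.exp_le_exp.2 ?_) (by positivity)
        nlinarith [sq_nonneg θ]

/-- The `2k`-th moment is read off the exponential moments at `±√k`, the scale at which the
sub-Gaussian factor is `exp (8 * k)`. -/
theorem sum_linear_threePoint_pow_le {ι : Type*} [Fintype ι] [DecidableEq ι] (a : ι → ℝ)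
    (ha : ∑ e, a e ^ 2 ≤ 2) {k : ℕ} (hk : 1 ≤ k) :
    ∑ η : ι → Fin 3, (∑ e, a e * threePoint (η e)) ^ (2 * k) ≤
      3 ^ Fintype.card ι * (8 * Real.exp 8 * k) ^ k := by
  have hk0 : (0 : ℝ) < k := by exact_mod_cast hk
  have hsq : √(k : ℝ) ^ 2 = k := Real.sq_sqrt hk0.le
  have hpt : ∀ z : ℝ, (k : ℝ) ^ k * z ^ (2 * k) ≤
      (2 * k).factorial * (Real.exp (√k * z) + Real.exp (-√k * z)) := by
    intro z
    have h1 := Real.pow_div_factorial_le_exp |√k * z| (abs_nonneg _) (2 * k)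
    have h2 : |√k * z| ^ (2 * k) = (k : ℝ) ^ k * z ^ (2 * k) := by
      rw [(even_two_mul k).pow_abs, mul_pow, pow_mul, hsq]
    rw [h2, div_le_iff₀ (by positivity), mul_comm (Real.exp _)] at h1
    refine h1.trans ?_
    gcongr
    rcases abs_choice (√k * z) with h | h <;> rw [h]
    · linarith [Real.exp_pos (-√k * z)]
    · rw [neg_mul]
      linarith [Real.exp_pos (√k * z)]
  have hsum : (k : ℝ) ^ k * ∑ η : ι → Fin 3, (∑ e, a e * threePoint (η e)) ^ (2 * k) ≤
      (2 * k).factorial * (2 * (3 ^ Fintype.card ι * Real.exp (8 * k))) := by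
    rw [Finset.mul_sum]
    refine (Finset.sum_le_sum fun η _ => hpt _).trans ?_
    rw [← Finset.mul_sum, Finset.sum_add_distrib]
    have h1 := sum_exp_linear_threePoint_le a (√k) ha
    have h2 := sum_exp_linear_threePoint_le a (-√k) ha
    rw [neg_sq, hsq] at h2
    rw [hsq] at h1
    gcongr
    linarith
  have hfac : ((2 * k).factorial : ℝ) ≤ (4 * k) ^ k * k ^ k := by
    have : ((2 * k).factorial : ℝ) ≤ ((2 * k) ^ (2 * k) : ℕ) :=
      Nat.cast_le.2 (Nat.factorial_le_pow _)
    refine this.trans_eq ?_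
    push_cast
    rw [pow_mul, ← mul_pow]
    ring
  have h2k : (2 : ℝ) ≤ 2 ^ k := by
    simpa using pow_le_pow_right₀ (a := (2 : ℝ)) (by norm_num) hk
  refine le_of_mul_le_mul_left (hsum.trans ?_) (pow_pos hk0 k)
  calc ((2 * k).factorial : ℝ) * (2 * (3 ^ Fintype.card ι * Real.exp (8 * k)))
      ≤ ((4 * k) ^ k * k ^ k) * (2 ^ k * (3 ^ Fintype.card ι * Real.exp (8 * k))) := by gcongr
    _ = k ^ k * (3 ^ Fintype.card ι * (8 * Real.exp 8 * k) ^ k) := by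
        rw [mul_comm 8 (k : ℝ), Real.exp_nat_mul, show (8 : ℝ) * Real.exp 8 * k =
          4 * k * 2 * Real.exp 8 by ring, mul_pow _ (Real.exp 8), mul_pow _ (2 : ℝ)]
        ring

/-- An unordered pair has at most two orderings; this is the only cost of symmetry in the dense
matrix. -/
theorem sum_sq_sum_sym2_fiber_le (f : V × V → ℝ) :
    ∑ e : Sym2 V, (∑ p : V × V with s(p.1, p.2) = e, f p) ^ 2 ≤ 2 * ∑ p, f p ^ 2 := by
  rw [← Finset.sum_fiberwise Finset.univ (fun p : V × V => s(p.1, p.2)), Finset.mul_sum]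
  refine Finset.sum_le_sum fun e _ => ?_
  refine sq_sum_le_card_mul_sum_sq.trans ?_
  have hcard : (Finset.univ.filter fun p : V × V => s(p.1, p.2) = e).card ≤ 2 := by
    induction e with
    | _ a b =>
      refine (Finset.card_le_card (t := {(a, b), (b, a)}) fun p hp => ?_).trans
        Finset.card_le_two
      simpa [Prod.ext_iff] using hp
  gcongr
  exact_mod_cast hcard

theorem sum_bilinear_threePointMatrix_pow_le (x y : EuclideanSpace ℝ V) (hx : ‖x‖ ≤ 1)
    (hy : ‖y‖ ≤ 1) {k : ℕ} (hk : 1 ≤ k) :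
    ∑ η : Sym2 V → Fin 3,
        (inner ℝ y (Matrix.toEuclideanCLM (n := V) (𝕜 := ℝ) (threePointMatrix η) x) : ℝ) ^ (2 * k) ≤
      3 ^ Fintype.card (Sym2 V) * (8 * Real.exp 8 * k) ^ k := by
  set a : Sym2 V → ℝ := fun e => ∑ p : V × V with s(p.1, p.2) = e, y p.1 * x p.2 with ha
  have hle : ∑ e, a e ^ 2 ≤ 2 := by
    refine (sum_sq_sum_sym2_fiber_le _).trans ?_
    have : ∑ p : V × V, (y p.1 * x p.2) ^ 2 = ‖y‖ ^ 2 * ‖x‖ ^ 2 := by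
      rw [EuclideanSpace.norm_sq_eq, EuclideanSpace.norm_sq_eq, Finset.sum_mul_sum,
        Fintype.sum_prod_type]
      simp [mul_pow]
    rw [this]
    have h1 : ‖y‖ ^ 2 ≤ 1 := pow_le_one₀ (norm_nonneg _) hy
    have h2 : ‖x‖ ^ 2 ≤ 1 := pow_le_one₀ (norm_nonneg _) hx
    nlinarith [sq_nonneg ‖x‖, sq_nonneg ‖y‖]
  refine le_of_eq_of_le ?_ (sum_linear_threePoint_pow_le a hle hk)
  refine Finset.sum_congr rfl fun η _ => ?_
  congr 1
  simp only [PiLp.inner_apply, Matrix.ofLp_toEuclideanCLM, Matrix.mulVec, dotProduct,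
    RCLike.inner_apply, conj_trivial, ha, Finset.sum_mul]
  rw [← Fintype.sum_prod_type', ← Finset.sum_fiberwise Finset.univ
    (fun p : V × V => s(p.1, p.2))]
  refine Finset.sum_congr rfl fun e _ => Finset.sum_congr rfl fun p hp => ?_
  rw [threePointMatrix, Matrix.of_apply, (Finset.mem_filter.1 hp).2]
  ring

/-- The dimension `2k + 1` and the number of pairs of net points are both at most exponential in
`k`; the constant is `3 * 16 * 15625 * 8`. -/
theorem sum_trace_threePointMatrix_pow_le {k : ℕ} (hk : 1 ≤ k) :
    ∑ η : Sym2 (Fin (2 * k + 1)) → Fin 3, (threePointMatrix η ^ (2 * k)).trace ≤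
      3 ^ Fintype.card (Sym2 (Fin (2 * k + 1))) * (6000000 * Real.exp 8 * k) ^ k := by
  obtain ⟨N, hcard, hN1, hN⟩ := exists_half_net (EuclideanSpace ℝ (Fin (2 * k + 1)))
  rw [finrank_euclideanSpace_fin] at hcard
  set S : ℝ := 3 ^ Fintype.card (Sym2 (Fin (2 * k + 1))) with hS
  have hS0 : 0 ≤ S := by positivity
  have h1 : ∀ η : Sym2 (Fin (2 * k + 1)) → Fin 3, (threePointMatrix η ^ (2 * k)).trace ≤
      (2 * k + 1) * (16 ^ k * ∑ p ∈ N ×ˢ N, (inner ℝ p.2 (Matrix.toEuclideanCLM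
        (n := Fin (2 * k + 1)) (𝕜 := ℝ) (threePointMatrix η) p.1) : ℝ) ^ (2 * k)) := by
    intro η
    refine (trace_le_mul_matrixSpectralNorm _).trans ?_
    push_cast
    gcongr
    exact (matrixSpectralNorm_pow_le _ (by omega)).trans (opNorm_pow_le_of_half_net _ hN k)
  have h2 : ((2 * k + 1 : ℕ) : ℝ) ≤ 3 ^ k := by
    have := one_add_mul_le_pow (a := (2 : ℝ)) (by norm_num) k
    push_cast
    norm_num at this ⊢
    linarith
  have h3 : ((N ×ˢ N).card : ℝ) ≤ 15625 ^ k := by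
    have h : (N ×ˢ N).card ≤ 15625 ^ k := by
      rw [Finset.card_product]
      calc N.card * N.card ≤ 5 ^ (2 * k + 1) * 5 ^ (2 * k + 1) := Nat.mul_le_mul hcard hcard
        _ ≤ 5 ^ (6 * k) := by
          rw [← pow_add]
          exact Nat.pow_le_pow_right (by norm_num) (by omega)
        _ = 15625 ^ k := by
          rw [pow_mul]
          norm_num
    exact_mod_cast h
  calc _ ≤ _ := Finset.sum_le_sum fun η _ => h1 η
    _ = (2 * k + 1 : ℕ) * (16 ^ k * ∑ p ∈ N ×ˢ N, ∑ η : Sym2 (Fin (2 * k + 1)) → Fin 3,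
        (inner ℝ p.2 (Matrix.toEuclideanCLM (n := Fin (2 * k + 1)) (𝕜 := ℝ)
          (threePointMatrix η) p.1) : ℝ) ^ (2 * k)) := by
        rw [← Finset.mul_sum, ← Finset.mul_sum, Finset.sum_comm]
        push_cast
        rfl
    _ ≤ (2 * k + 1 : ℕ) * (16 ^ k * ∑ p ∈ N ×ˢ N, S * (8 * Real.exp 8 * k) ^ k) := by
        gcongr with p hp
        rw [Finset.mem_product] at hp
        exact sum_bilinear_threePointMatrix_pow_le _ _ (hN1 _ hp.1) (hN1 _ hp.2) hk
    _ = (2 * k + 1 : ℕ) * (16 ^ k * ((N ×ˢ N).card * (S * (8 * Real.exp 8 * k) ^ k))) := by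
        rw [Finset.sum_const, nsmul_eq_mul]
    _ ≤ 3 ^ k * (16 ^ k * (15625 ^ k * (S * (8 * Real.exp 8 * k) ^ k))) := by gcongr
    _ = S * (6000000 * Real.exp 8 * k) ^ k := by
        rw [show (6000000 : ℝ) * Real.exp 8 * k = 3 * (16 * (15625 * (8 * Real.exp 8 * k))) by ring,
          mul_pow 3, mul_pow 16, mul_pow 15625]
        ring

end ThreePoint

/-! ### Multiplicities of edges along a walk. -/

section StepCount

variable {V : Type*} {m : ℕ}

/-- The number of steps of a walk which use a given edge. -/
def stepCount [DecidableEq V] (w : Fin (m + 1) → V) (e : Sym2 V) : ℕ :=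
  (Finset.univ.filter fun l => stepEdge w l = e).card

variable [DecidableEq V]

theorem EveryStepRepeated.stepCount_ne_one {w : Fin (m + 1) → V} (hw : EveryStepRepeated w)
    (e : Sym2 V) : stepCount w e ≠ 1 := by
  intro h
  obtain ⟨l, hl⟩ := Finset.card_eq_one.1 h
  have hle : stepEdge w l = e :=
    (Finset.mem_filter.1 (hl.symm ▸ Finset.mem_singleton_self l : l ∈ Finset.univ.filter _)).2
  obtain ⟨l', hne, hl'⟩ := hw l
  have : l' ∈ Finset.univ.filter fun l => stepEdge w l = e :=
    Finset.mem_filter.2 ⟨Finset.mem_univ _, hl'.trans hle⟩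
  rw [hl] at this
  exact hne (Finset.mem_singleton.1 this)

theorem exists_stepCount_eq_one {w : Fin (m + 1) → V} (hw : ¬ EveryStepRepeated w) :
    ∃ e, stepCount w e = 1 := by
  simp only [EveryStepRepeated, not_forall, not_exists, not_and] at hw
  obtain ⟨l, hl⟩ := hw
  refine ⟨stepEdge w l, Finset.card_eq_one.2 ⟨l, ?_⟩⟩
  ext l'
  simp only [Finset.mem_filter, Finset.mem_univ, true_and, Finset.mem_singleton]
  exact ⟨fun h => by_contra fun hne => hl l' hne h, fun h => by rw [h]⟩

theorem prod_steps_eq_prod_pow_stepCount [Fintype V] (w : Fin (m + 1) → V) (f : Sym2 V → ℝ) :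
    ∏ l, f (stepEdge w l) = ∏ e, f e ^ stepCount w e := by
  rw [← Finset.prod_fiberwise Finset.univ (stepEdge w)]
  refine Finset.prod_congr rfl fun e _ => ?_
  rw [stepCount, ← Finset.prod_const]
  exact Finset.prod_congr rfl fun l hl => by rw [(Finset.mem_filter.1 hl).2]

theorem stepCount_eq_zero_iff {w : Fin (m + 1) → V} {e : Sym2 V} :
    stepCount w e = 0 ↔ e ∉ Finset.univ.image (stepEdge w) := by
  simp [stepCount, Finset.filter_eq_empty_iff]

end StepCount

-- Summed over `η`, each closed walk contributes a product of nonnegative moment sums. When no edge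
-- is used exactly once, each factor is at least 3, so such a walk is counted with weight at least
-- `3 ^ card (Sym2 V)`.
open Classical in
theorem card_repeated_closed_walks_le {V : Type*} [Fintype V] [DecidableEq V] (m : ℕ) :
    (3 : ℝ) ^ Fintype.card (Sym2 V) * ((Finset.univ.filter fun w : Fin (m + 1) → V =>
        IsRepeatedClosed (Setoid.ker w)).card : ℝ) ≤
      ∑ η : Sym2 V → Fin 3, (threePointMatrix η ^ m).trace := by
  have hprod : ∀ w : Fin (m + 1) → V, ∑ η : Sym2 V → Fin 3,
      ∏ l : Fin m, threePointMatrix η (w l.castSucc) (w l.succ) =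
        ∏ e, ∑ j, threePoint j ^ stepCount w e := by
    intro w
    rw [Fintype.prod_sum]
    exact Finset.sum_congr rfl fun η _ =>
      prod_steps_eq_prod_pow_stepCount w fun e => threePoint (η e)
  simp only [trace_pow_eq_sum_closed_walks]
  rw [Finset.sum_comm, mul_comm, ← nsmul_eq_mul, ← Finset.sum_const]
  simp only [hprod]
  calc _ ≤ ∑ w : Fin (m + 1) → V with IsRepeatedClosed (Setoid.ker w),
        ∏ e, ∑ j, threePoint j ^ stepCount w e := by
        refine Finset.sum_le_sum fun w hw => ?_
        have hw' := ((isRepeatedClosed_ker w).1 (Finset.mem_filter.1 hw).2).2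
        rw [← Finset.card_univ, ← Finset.prod_const]
        exact Finset.prod_le_prod (fun _ _ => by norm_num) fun e _ =>
          three_le_sum_threePoint_pow (hw'.stepCount_ne_one e)
    _ ≤ _ := by
        refine Finset.sum_le_sum_of_subset_of_nonneg ?_ fun w _ _ =>
          Finset.prod_nonneg fun e _ => sum_threePoint_pow_nonneg _
        intro w hw
        simp only [Finset.mem_filter, Finset.mem_univ, true_and] at hw ⊢
        exact ((isRepeatedClosed_ker w).1 hw).1

/-- The moment bound for a sparse matrix, in purely combinatorial form. -/
theorem sum_repeated_closed_walks_le_pow {n k : ℕ}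
    [DecidablePred fun w : Fin (2 * k + 1) → Fin n =>
      w 0 = w (Fin.last (2 * k)) ∧ EveryStepRepeated w] (hk : 1 ≤ k) {q : ℝ} (hq : 0 ≤ q)
    (hqk : n * q ≤ k) :
    ∑ w : Fin (2 * k + 1) → Fin n with
        w 0 = w (Fin.last (2 * k)) ∧ EveryStepRepeated w,
        q ^ ((Finset.univ.image w).card - 1) ≤ n * (6000000 * Real.exp 8 * k) ^ k := by
  classical
  have h1 := sum_repeated_closed_walks_le (V := Fin n) (W := Fin (2 * k + 1)) hk
    (Fintype.card_fin _) hq (by rwa [Fintype.card_fin])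
  have h2 := (card_repeated_closed_walks_le (V := Fin (2 * k + 1)) (2 * k)).trans
    (sum_trace_threePointMatrix_pow_le hk)
  have h3 := le_of_mul_le_mul_left h2 (pow_pos three_pos _)
  rw [Fintype.card_fin] at h1
  have h4 := h1.trans (mul_le_mul_of_nonneg_left h3 (Nat.cast_nonneg n))
  refine le_of_eq_of_le ?_ h4
  refine Finset.sum_congr ?_ fun w _ => ?_
  · ext w
    simp only [Finset.mem_filter, isRepeatedClosed_ker]
  · congr!

/-! ### Moment and tail bounds for sparse symmetric random matrices. -/

section RandomMatrix

variable {Ω : Type*} [MeasurableSpace Ω] {μ : Measure Ω} [IsProbabilityMeasure μ] {n : ℕ}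

/-- The symmetric matrix with upper triangular entries given by a family indexed by unordered
pairs. -/
def symMatrix (ξ : Sym2 (Fin n) → ℝ) : Matrix (Fin n) (Fin n) ℝ :=
  Matrix.of fun i j => ξ s(i, j)

theorem symMatrix_isSymm (ξ : Sym2 (Fin n) → ℝ) : (symMatrix ξ).IsSymm := by
  ext i j
  simp [symMatrix, Sym2.eq_swap]

theorem abs_integral_pow_le {ξ : Ω → ℝ} (hm : Measurable ξ) (hb : ∀ ω, |ξ ω| ≤ 1) {q : ℝ}
    (hv : ∫ ω, ξ ω ^ 2 ∂μ ≤ q) {m : ℕ} (h2 : 2 ≤ m) : |∫ ω, ξ ω ^ m ∂μ| ≤ q := by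
  have hint : ∀ j : ℕ, Integrable (fun ω => ξ ω ^ j) μ := fun j =>
    Integrable.of_bound (hm.pow_const j).aestronglyMeasurable 1 (.of_forall fun ω => by
      rw [norm_pow]
      exact pow_le_one₀ (norm_nonneg _) (hb ω))
  refine (abs_integral_le_integral_abs).trans (le_trans ?_ hv)
  refine integral_mono (hint m).abs (hint 2) fun ω => ?_
  change |ξ ω ^ m| ≤ ξ ω ^ 2
  rw [abs_pow, ← sq_abs]
  exact pow_le_pow_of_le_one (abs_nonneg _) (hb ω) h2

theorem integrable_prod_walk {ξ : Sym2 (Fin n) → Ω → ℝ} (hm : ∀ e, Measurable (ξ e))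
    (hb : ∀ e ω, |ξ e ω| ≤ 1) {m : ℕ} (w : Fin (m + 1) → Fin n) :
    Integrable (fun ω => ∏ l : Fin m, ξ (stepEdge w l) ω) μ := by
  refine Integrable.of_bound (Finset.measurable_fun_prod _ fun l _ => hm _).aestronglyMeasurable 1
    (.of_forall fun ω => ?_)
  rw [norm_prod]
  exact Finset.prod_le_one (fun _ _ => norm_nonneg _) fun l _ => hb _ ω

/-- Independence factors the mean over edges. An edge used once gives a factor 0; when there is
none, each edge used gives at most `q`, and there are at least as many edges as visited vertices
minus one. -/
theorem integral_prod_walk_le {ξ : Sym2 (Fin n) → Ω → ℝ} (hm : ∀ e, Measurable (ξ e))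
    (hind : iIndepFun ξ μ) (hb : ∀ e ω, |ξ e ω| ≤ 1) (h0 : ∀ e, ∫ ω, ξ e ω ∂μ = 0) {q : ℝ}
    (hq : 0 ≤ q) (hq1 : q ≤ 1) (hv : ∀ e, ∫ ω, ξ e ω ^ 2 ∂μ ≤ q) {m : ℕ}
    (w : Fin (m + 1) → Fin n) [Decidable (EveryStepRepeated w)] :
    ∫ ω, ∏ l : Fin m, ξ (stepEdge w l) ω ∂μ ≤
      if EveryStepRepeated w then q ^ ((Finset.univ.image w).card - 1) else 0 := by
  have h : ∫ ω, ∏ l : Fin m, ξ (stepEdge w l) ω ∂μ =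
      ∏ e, ∫ ω, ξ e ω ^ stepCount w e ∂μ := by
    simp only [fun ω => prod_steps_eq_prod_pow_stepCount w fun e => ξ e ω]
    exact hind.integral_fun_prod_comp (f := fun e x => x ^ stepCount w e)
      (fun e => (hm e).aemeasurable) fun e => (measurable_id.pow_const _).aestronglyMeasurable
  rw [h]
  split_ifs with hw
  · calc ∏ e, ∫ ω, ξ e ω ^ stepCount w e ∂μ
        ≤ ∏ e, |∫ ω, ξ e ω ^ stepCount w e ∂μ| := by
          rw [← Finset.abs_prod]
          exact le_abs_self _
      _ ≤ ∏ e, if e ∈ Finset.univ.image (stepEdge w) then q else 1 := by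
          refine Finset.prod_le_prod (fun _ _ => abs_nonneg _) fun e _ => ?_
          split_ifs with he
          · have h1 := hw.stepCount_ne_one e
            have h2 := stepCount_eq_zero_iff.not_left.2 he
            exact abs_integral_pow_le (hm e) (hb e) (hv e) (by omega)
          · rw [stepCount_eq_zero_iff.2 he]
            simp
      _ = q ^ (Finset.univ.image (stepEdge w)).card := by
          rw [Finset.prod_ite_mem, Finset.univ_inter, Finset.prod_const]
      _ ≤ _ := by
          refine pow_le_pow_of_le_one hq hq1 ?_
          have := card_image_walk_le w
          omega
  · obtain ⟨e, he⟩ := exists_stepCount_eq_one hw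
    refine (Finset.prod_eq_zero (Finset.mem_univ e) ?_).le
    rw [he]
    simpa using h0 e

theorem trace_symMatrix_pow (ξ : Sym2 (Fin n) → ℝ) (m : ℕ) :
    (symMatrix ξ ^ m).trace = ∑ w : Fin (m + 1) → Fin n with w 0 = w (Fin.last m),
      ∏ l : Fin m, ξ (stepEdge w l) :=
  trace_pow_eq_sum_closed_walks _ m

theorem integrable_trace_symMatrix_pow {ξ : Sym2 (Fin n) → Ω → ℝ} (hm : ∀ e, Measurable (ξ e))
    (hb : ∀ e ω, |ξ e ω| ≤ 1) (m : ℕ) :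
    Integrable (fun ω => (symMatrix (fun e => ξ e ω) ^ m).trace) μ := by
  simp only [trace_symMatrix_pow]
  exact integrable_finsetSum _ fun w _ => integrable_prod_walk hm hb w

theorem integral_trace_symMatrix_pow_le {ξ : Sym2 (Fin n) → Ω → ℝ} (hm : ∀ e, Measurable (ξ e))
    (hind : iIndepFun ξ μ) (hb : ∀ e ω, |ξ e ω| ≤ 1) (h0 : ∀ e, ∫ ω, ξ e ω ∂μ = 0) {q : ℝ}
    (hq : 0 ≤ q) (hq1 : q ≤ 1) (hv : ∀ e, ∫ ω, ξ e ω ^ 2 ∂μ ≤ q) {k : ℕ} (hk : 1 ≤ k)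
    (hqk : n * q ≤ k) :
    ∫ ω, (symMatrix (fun e => ξ e ω) ^ (2 * k)).trace ∂μ ≤
      n * (6000000 * Real.exp 8 * k) ^ k := by
  classical
  simp only [trace_symMatrix_pow]
  rw [integral_finsetSum _ fun w _ => integrable_prod_walk hm hb w]
  refine (Finset.sum_le_sum fun w _ => integral_prod_walk_le hm hind hb h0 hq hq1 hv w).trans ?_
  rw [← Finset.sum_filter, Finset.filter_filter]
  exact sum_repeated_closed_walks_le_pow hk hq hqk

/-- A spectral norm tail bound for sparse symmetric matrices with independent entries. -/
theorem one_sub_le_measureReal_matrixSpectralNorm {ξ : Sym2 (Fin n) → Ω → ℝ}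
    (hm : ∀ e, Measurable (ξ e))
    (hind : iIndepFun ξ μ) (hb : ∀ e ω, |ξ e ω| ≤ 1) (h0 : ∀ e, ∫ ω, ξ e ω ∂μ = 0) {q : ℝ}
    (hq : 0 ≤ q) (hq1 : q ≤ 1) (hv : ∀ e, ∫ ω, ξ e ω ^ 2 ∂μ ≤ q) (j : ℕ)
    (hqk : n * q ≤ (2 ^ j : ℕ)) {B : ℝ} (hB0 : 0 ≤ B)
    (hB : 6000000 * Real.exp 9 * (2 ^ j : ℕ) ≤ B ^ 2) :
    1 - n * Real.exp (-(2 ^ j : ℕ)) ≤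
      μ.real {ω | matrixSpectralNorm (symMatrix fun e => ξ e ω) ≤ B} := by
  set k : ℕ := 2 ^ j with hkdef
  have hk : 1 ≤ k := Nat.one_le_two_pow
  have hk0 : (0 : ℝ) < k := by exact_mod_cast hk
  set X : Ω → ℝ := fun ω => (symMatrix (fun e => ξ e ω) ^ (2 * k)).trace with hX
  have hXint : Integrable X μ := integrable_trace_symMatrix_pow hm hb _
  have hXnn : ∀ ω, 0 ≤ X ω := fun ω => by
    refine le_trans ?_ (matrixSpectralNorm_pow_le_trace (symMatrix_isSymm _) j)
    exact pow_nonneg (norm_nonneg _) _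
  have hBk : 0 < B ^ (2 * k) := by
    rw [pow_mul]
    have : 0 < B ^ 2 := lt_of_lt_of_le (by positivity) hB
    positivity
  have hmarkov := mul_meas_ge_le_integral_of_nonneg (.of_forall hXnn) hXint (B ^ (2 * k))
  have hEX := integral_trace_symMatrix_pow_le hm hind hb h0 hq hq1 hv hk hqk
  have htail : μ.real {ω | B ^ (2 * k) ≤ X ω} ≤ n * Real.exp (-k) := by
    refine le_of_mul_le_mul_left ((hmarkov.trans hEX).trans ?_) hBk
    -- The spare factor `e` between `exp 8` and `exp 9`, raised to the power `k`, is the whole tail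
    -- decay.
    have : (6000000 * Real.exp 8 * k) ^ k ≤ B ^ (2 * k) * Real.exp (-k) := by
      rw [pow_mul, show Real.exp (-(k : ℝ)) = Real.exp (-1) ^ k by
        rw [← Real.exp_nat_mul, mul_neg_one], ← mul_pow]
      refine pow_le_pow_left₀ (by positivity) ?_ _
      calc 6000000 * Real.exp 8 * k = (6000000 * Real.exp 9 * k) * Real.exp (-1) := by
            rw [show (8 : ℝ) = 9 + -1 by norm_num, Real.exp_add]
            ring
        _ ≤ _ := by gcongr
    calc (n : ℝ) * (6000000 * Real.exp 8 * k) ^ k ≤ n * (B ^ (2 * k) * Real.exp (-k)) := by gcongr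
      _ = _ := by ring
  have hXm : NullMeasurableSet {ω | B ^ (2 * k) ≤ X ω} μ :=
    nullMeasurableSet_le aemeasurable_const hXint.aemeasurable
  have hcompl := probReal_compl_eq_one_sub₀ hXm
  refine le_trans (by linarith) (hcompl.ge.trans (measureReal_mono fun ω hω => ?_))
  simp only [Set.mem_compl_iff, Set.mem_ofPred_eq, not_le] at hω ⊢
  exact le_of_pow_le_pow_left₀ (by omega) hB0
    ((matrixSpectralNorm_pow_le_trace (symMatrix_isSymm _) j).trans hω.le)

end RandomMatrix

/-! ### Centred edge indicators of the random graph. -/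

section RandomGraph

variable {Ω : Type*} {n : ℕ} {G : Ω → SimpleGraph (Fin n)}

/-- The event that `e` is an edge of the random graph. -/
def edgeEvent (G : Ω → SimpleGraph (Fin n)) (e : Sym2 (Fin n)) : Set Ω :=
  {ω | e ∈ (G ω).edgeSet}

theorem edgeEvent_eq_empty_of_isDiag {e : Sym2 (Fin n)} (he : e.IsDiag) : edgeEvent G e = ∅ :=
  Set.eq_empty_of_forall_notMem fun ω h => (G ω).not_isDiag_of_mem_edgeSet h he

theorem adjacencyMatrix_apply_eq_indicator (ω : Ω) (i j : Fin n) :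
    adjacencyMatrix (G ω) i j = (edgeEvent G s(i, j)).indicator 1 ω := by
  classical
  simp [adjacencyMatrix, SimpleGraph.adjMatrix_apply, Set.indicator_apply, edgeEvent]

variable [MeasurableSpace Ω] {μ : Measure Ω}

theorem IndependentEdges.measurableSet_edgeEvent (h : IndependentEdges μ G) (e : Sym2 (Fin n)) :
    MeasurableSet (edgeEvent G e) := by
  by_cases he : e.IsDiag
  · rw [edgeEvent_eq_empty_of_isDiag he]
    exact MeasurableSet.empty
  · exact h.measurable ⟨e, he⟩

/-- Loops give the empty event, so adding them preserves independence and the family can be indexed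
by all of `Sym2`. -/
theorem IndependentEdges.iIndepSet_edgeEvent (h : IndependentEdges μ G) :
    iIndepSet (edgeEvent G) μ := by
  classical
  rw [iIndepSet_iff_meas_biInter h.measurableSet_edgeEvent]
  intro s
  by_cases hs : ∃ e ∈ s, e.IsDiag
  · obtain ⟨e, hes, he⟩ := hs
    rw [Finset.prod_eq_zero hes (by rw [edgeEvent_eq_empty_of_isDiag he, measure_empty])]
    refine measure_mono_null (Set.biInter_subset_of_mem hes) ?_
    rw [edgeEvent_eq_empty_of_isDiag he, measure_empty]
  · push Not at hs
    have := (iIndepSet_iff_meas_biInter h.measurable).1 h.indep (s.subtype fun e => ¬ e.IsDiag)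
    have h1 : ⋂ e : {e : Sym2 (Fin n) // ¬ e.IsDiag},
        ⋂ _ : e ∈ s.subtype fun e : Sym2 (Fin n) => ¬ e.IsDiag, {ω | e.1 ∈ (G ω).edgeSet} =
        ⋂ e ∈ s, edgeEvent G e := by
      ext ω
      simp only [Set.mem_iInter, Finset.mem_subtype]
      exact ⟨fun hω e he => hω ⟨e, hs e he⟩ he, fun hω e he => hω e.1 he⟩
    rw [h1] at this
    rw [this]
    exact Finset.prod_subtype_of_mem (fun e => μ (edgeEvent G e)) hs

/-- The centred indicator of an edge. -/
noncomputable def centredEdge (μ : Measure Ω) (G : Ω → SimpleGraph (Fin n)) (e : Sym2 (Fin n))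
    (ω : Ω) : ℝ :=
  (edgeEvent G e).indicator 1 ω - μ.real (edgeEvent G e)

theorem IndependentEdges.measurable_centredEdge (h : IndependentEdges μ G) (e : Sym2 (Fin n)) :
    Measurable (centredEdge μ G e) :=
  (measurable_one.indicator (h.measurableSet_edgeEvent e)).sub_const _

theorem IndependentEdges.iIndepFun_centredEdge (h : IndependentEdges μ G) :
    iIndepFun (centredEdge μ G) μ :=
  (h.iIndepSet_edgeEvent.iIndepFun_indicator (β := ℝ)).comp
    (fun e x => x - μ.real (edgeEvent G e)) fun _ => measurable_id.sub_const _

theorem IndependentEdges.matrixExpectation_apply (h : IndependentEdges μ G) (i j : Fin n) :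
    matrixExpectation μ (fun ω => adjacencyMatrix (G ω)) i j = μ.real (edgeEvent G s(i, j)) := by
  simp only [matrixExpectation, Matrix.of_apply, adjacencyMatrix_apply_eq_indicator]
  exact integral_indicator_one (h.measurableSet_edgeEvent _)

theorem IndependentEdges.adjacencyMatrix_sub_matrixExpectation (h : IndependentEdges μ G)
    (ω : Ω) :
    adjacencyMatrix (G ω) - matrixExpectation μ (fun ω => adjacencyMatrix (G ω)) =
      symMatrix fun e => centredEdge μ G e ω := by
  ext i j
  rw [Matrix.sub_apply, h.matrixExpectation_apply, adjacencyMatrix_apply_eq_indicator]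
  rfl

variable [IsProbabilityMeasure μ]

theorem abs_centredEdge_le (e : Sym2 (Fin n)) (ω : Ω) : |centredEdge μ G e ω| ≤ 1 := by
  have h0 : 0 ≤ μ.real (edgeEvent G e) := measureReal_nonneg
  have h1 : μ.real (edgeEvent G e) ≤ 1 := measureReal_le_one
  rw [abs_le, centredEdge]
  by_cases hω : ω ∈ edgeEvent G e
  · rw [Set.indicator_of_mem hω, Pi.one_apply]
    constructor <;> linarith
  · rw [Set.indicator_of_notMem hω]
    constructor <;> linarith

theorem IndependentEdges.integrable_indicator (h : IndependentEdges μ G) (e : Sym2 (Fin n)) :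
    Integrable ((edgeEvent G e).indicator (1 : Ω → ℝ)) μ :=
  (integrable_const (1 : ℝ)).indicator (h.measurableSet_edgeEvent e)

theorem IndependentEdges.integral_centredEdge (h : IndependentEdges μ G) (e : Sym2 (Fin n)) :
    ∫ ω, centredEdge μ G e ω ∂μ = 0 := by
  simp only [centredEdge]
  rw [integral_sub (h.integrable_indicator e) (integrable_const _),
    integral_indicator_one (h.measurableSet_edgeEvent e)]
  simp

theorem IndependentEdges.integral_centredEdge_sq_le (h : IndependentEdges μ G)
    (e : Sym2 (Fin n)) :
    ∫ ω, centredEdge μ G e ω ^ 2 ∂μ ≤ μ.real (edgeEvent G e) := by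
  set p := μ.real (edgeEvent G e) with hp
  have hpt : ∀ ω, centredEdge μ G e ω ^ 2 =
      (1 - 2 * p) * (edgeEvent G e).indicator 1 ω + p ^ 2 := by
    intro ω
    rw [centredEdge]
    by_cases hω : ω ∈ edgeEvent G e
    · rw [Set.indicator_of_mem hω, Pi.one_apply]
      ring
    · rw [Set.indicator_of_notMem hω]
      ring
  simp only [hpt]
  rw [integral_add ((h.integrable_indicator e).const_mul _) (integrable_const _),
    integral_const_mul, integral_indicator_one (h.measurableSet_edgeEvent e)]
  simp only [integral_const, probReal_univ, one_smul, ← hp]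
  nlinarith [sq_nonneg p]

end RandomGraph

/-! ### Choice of constants and conclusion. -/

theorem theorem5p2 (r c₀ : ℝ) (hr : 0 < r) (hc₀ : 0 < c₀) :
    ∃ C : ℝ, 0 < C ∧
      ∀ (n : ℕ) (d : ℝ) (Ω : Type*) [MeasurableSpace Ω] (μ : Measure Ω) [IsProbabilityMeasure μ]
        (G : Ω → SimpleGraph (Fin n)) (P : Matrix (Fin n) (Fin n) ℝ),
        IndependentEdges μ G →
        matrixExpectation μ (fun ω => adjacencyMatrix (G ω)) = P →
        (∀ i j, (n : ℝ) * P i j ≤ d) →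
        c₀ * Real.log n ≤ d →
        1 - (n : ℝ) ^ (-r) ≤
          μ.real {ω | matrixSpectralNorm (adjacencyMatrix (G ω) - P) ≤ C * Real.sqrt d} := by
  have hlog2 : 0 < Real.log 2 := Real.log_pos one_lt_two
  -- For `n ≥ 2` the three summands give in turn `d ≤ L * d`, `(r + 1) * log n ≤ L * d` and `1 ≤ L *
  -- d`.
  set L : ℝ := 1 + (r + 1) / c₀ + 1 / (c₀ * Real.log 2) with hL
  have hL1 : 0 ≤ (r + 1) / c₀ := by positivity
  have hL2 : 0 ≤ 1 / (c₀ * Real.log 2) := by positivity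
  have hL0 : 0 < L := by positivity
  have hC : 0 < 6000000 * Real.exp 9 * (2 * L) := by positivity
  refine ⟨√(6000000 * Real.exp 9 * (2 * L)), Real.sqrt_pos.2 hC, ?_⟩
  rintro n d Ω _ μ _ G P hG rfl hd hdn
  rcases Nat.lt_or_ge n 2 with hn | hn
  -- For `n = 0` the convention `0 ^ (-r) = 0` demands probability one, and the norm vanishes; for
  -- `n = 1` the lower bound is 0.
  · interval_cases n
    · have huniv : {ω | matrixSpectralNorm (adjacencyMatrix (G ω) -
          matrixExpectation μ fun ω => adjacencyMatrix (G ω)) ≤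
          √(6000000 * Real.exp 9 * (2 * L)) * √d} = Set.univ := by
        refine Set.eq_univ_of_forall fun ω => ?_
        have : matrixSpectralNorm (adjacencyMatrix (G ω) -
            matrixExpectation μ fun ω => adjacencyMatrix (G ω)) = 0 := by
          rw [matrixSpectralNorm, Subsingleton.elim (adjacencyMatrix (G ω) - _) 0, map_zero,
            norm_zero]
        exact this.le.trans (by positivity)
      rw [huniv, probReal_univ]
      simp [Real.zero_rpow (neg_ne_zero.2 hr.ne')]
    · simp
  have hn0 : (0 : ℝ) < n := by exact_mod_cast (show 0 < n by omega)
  have hlog : Real.log 2 ≤ Real.log n :=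
    Real.log_le_log two_pos (by exact_mod_cast hn)
  have hd0 : 0 < d := (mul_pos hc₀ (hlog2.trans_le hlog)).trans_le hdn
  have hLd1 : 1 ≤ L * d := by
    calc (1 : ℝ) = 1 / (c₀ * Real.log 2) * (c₀ * Real.log 2) := by field_simp
      _ ≤ L * d := by
        refine mul_le_mul (by linarith) (le_trans ?_ hdn) (by positivity) hL0.le
        gcongr
  have hLd2 : (r + 1) * Real.log n ≤ L * d := by
    calc (r + 1) * Real.log n = (r + 1) / c₀ * (c₀ * Real.log n) := by field_simp
      _ ≤ L * d := mul_le_mul (by linarith) hdn (by positivity) hL0.le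
  have hLd3 : d ≤ L * d := le_mul_of_one_le_left hd0.le (by linarith)
  -- The moment parameter is `k = 2 ^ (j + 1)`, which lies in `(L * d, 2 * L * d]`; hence the `2 *
  -- L` in the constant.
  obtain ⟨j, hj1, hj2⟩ := exists_nat_pow_near hLd1 one_lt_two
  -- The cap at 1 covers `d > n`: the walk estimate needs `q ≤ 1`.
  have hq0 : 0 ≤ min 1 (d / n) := le_min zero_le_one (by positivity)
  have hv : ∀ e, ∫ ω, centredEdge μ G e ω ^ 2 ∂μ ≤ min 1 (d / n) := by
    intro e
    refine (hG.integral_centredEdge_sq_le e).trans (le_min measureReal_le_one ?_)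
    induction e with
    | _ a b =>
      rw [le_div_iff₀ hn0, ← hG.matrixExpectation_apply, mul_comm]
      exact hd a b
  have hmain := one_sub_le_measureReal_matrixSpectralNorm (μ := μ) hG.measurable_centredEdge
    hG.iIndepFun_centredEdge abs_centredEdge_le hG.integral_centredEdge hq0 (min_le_left _ _) hv
    (j + 1) (B := √(6000000 * Real.exp 9 * (2 * L)) * √d)
    (by
      push_cast
      calc (n : ℝ) * min 1 (d / n) ≤ n * (d / n) := by
            gcongr
            exact min_le_right _ _
        _ = d := by field_simp
        _ ≤ 2 ^ (j + 1) := by linarith)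
    (by positivity)
    (by
      push_cast
      rw [mul_pow, Real.sq_sqrt hC.le, Real.sq_sqrt hd0.le, pow_succ, mul_assoc _ (2 * L)]
      exact mul_le_mul_of_nonneg_left (by linarith) (by positivity))
  simp only [hG.adjacencyMatrix_sub_matrixExpectation]
  refine le_trans (sub_le_sub_left ?_ 1) hmain
  push_cast
  calc (n : ℝ) * Real.exp (-2 ^ (j + 1)) ≤ n * Real.exp (-((r + 1) * Real.log n)) := by
        gcongr
        linarith
    _ = (n : ℝ) ^ (-r) := by
        rw [Real.rpow_def_of_pos hn0, show Real.log n * -r =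
          Real.log n + -((r + 1) * Real.log n) by ring, Real.exp_add, Real.exp_log hn0]
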